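/- Let $\varphi:\mathbb R\to\mathbb R$ be the piecewise linear function with $\varphi(x)=-1$ for $x<-1$, $\varphi(x)=x$ for $-1\le x\le 1$ and $\varphi(x)=1$ for $x>1$. Let $k_1,\eta\in\mathbb R$ be such that neither ($k_1=1$ and $\eta\equiv\pi \pmod{2\pi}$) nor ($k_1=-1$ and $\eta\equiv 0\pmod{2\pi}$). For $\varepsilon>0$ consider the planar system $$\dot x_1=x_2-x_1(x_1^2+x_2^2-1),\qquad \dot x_2=-x_1-x_2(x_1^2+x_2^2-1)+\varepsilon\bigl(\sin t+\varphi(k_1\sin(t+\eta))\bigr).$$ Put $\xi(\theta)=(\sin\theta,\cos\theta)$, $I(k)=\int_0^{2\pi}\sin t\,\varphi(k\sin t)\,dt$ and $M^\eta(\theta)=\pi\cos\theta+I(k_1)\cos(\theta-\eta)$. Call a $2\pi$-periodic solution $x$ isolated if it is the only $2\pi$-periodic solution with initial condition (value at $t=0$) in some ball around $x(0)$. Then $M^\eta$ has exactly two zeros $\theta_1\ne\theta_2$ in $[0,2\pi)$, and there are $\varepsilon_1>0$ and $\delta>0$ such that for every $\varepsilon\in(0,\varepsilon_1]$ the system has exactly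 two $2\pi$-periodic solutions $x_{1,\varepsilon}\neq x_{2,\varepsilon}$ whose initial condition lies at distance less than $\delta$ from the unit circle $\xi(\mathbb R)$. Both are isolated, and $x_{1,\varepsilon}(0)\to\xi(\theta_1)$ and $x_{2,\varepsilon}(0)\to\xi(\theta_2)$ as $\varepsilon\to0^+$. -/

import Mathlib

open Set Filter Topology

namespace ForcedPlanar

/-- The piecewise linear saturation function: `-1` for `x < -1`, `x` on `[-1, 1]`,
`1` for `x > 1`. -/
noncomputable def sat (x : ℝ) : ℝ :=
  if x < -1 then -1 else if x ≤ 1 then x else 1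

/-- The right-hand side of the planar system
`x₁' = x₂ - x₁ (x₁² + x₂² - 1)`,
`x₂' = -x₁ - x₂ (x₁² + x₂² - 1) + ε (sin t + φ (k sin (t + η)))`, with `φ = sat`. -/
noncomputable def field (k η ε t : ℝ) (z : ℝ × ℝ) : ℝ × ℝ :=
  (z.2 - z.1 * (z.1 ^ 2 + z.2 ^ 2 - 1),
   -z.1 - z.2 * (z.1 ^ 2 + z.2 ^ 2 - 1)
     + ε * (Real.sin t + sat (k * Real.sin (t + η))))

/-- `x` is a `2π`-periodic solution, defined on all of `ℝ`, of the planar system. -/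
def IsPeriodicSolution (k η ε : ℝ) (x : ℝ → ℝ × ℝ) : Prop :=
  (∀ t, HasDerivAt x (field k η ε t (x t)) t) ∧ Function.Periodic x (2 * Real.pi)

/-- `x` is an isolated `2π`-periodic solution: it is the only `2π`-periodic solution whose
initial condition lies in some ball around `x 0`. -/
def IsIsolatedPeriodicSolution (k η ε : ℝ) (x : ℝ → ℝ × ℝ) : Prop :=
  IsPeriodicSolution k η ε x ∧
    ∃ ρ > 0, ∀ y, IsPeriodicSolution k η ε y → dist (y 0) (x 0) < ρ → y = x

/-- The initial conditions `ξ(θ) = (sin θ, cos θ)` of the `2π`-periodic orbits of the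
unperturbed system on the unit circle. -/
noncomputable def xi (θ : ℝ) : ℝ × ℝ := (Real.sin θ, Real.cos θ)

/-- `I(k) = ∫₀^{2π} sin t · φ(k sin t) dt`. -/
noncomputable def I (k : ℝ) : ℝ :=
  ∫ t in (0 : ℝ)..(2 * Real.pi), Real.sin t * sat (k * Real.sin t)

/-- The bifurcation function `M^η(θ) = π cos θ + I(k) cos (θ - η)`. -/
noncomputable def M (k η θ : ℝ) : ℝ :=
  Real.pi * Real.cos θ + I k * Real.cos (θ - η)

end ForcedPlanar

/-!
The unperturbed system fills the unit circle with the `2π`-periodic solutions `xi (t + a)`, and the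
circle attracts nearby orbits. The proof is a Lyapunov–Schmidt reduction in a Banach space of
periodic functions, which avoids differentiating the flow with respect to initial conditions.

Write a solution in the frame rotating with `xi (t + a)`, with radial coordinate `1 + ε p` and
tangential coordinate `ε q`, where the phase `a` is chosen so that `q 0 = 0` (`orbit`). After
division by `ε` the system becomes
`p' = -2p + f cos (t + a) + O(ε)` and `q' = -f sin (t + a) + O(ε)`, polynomial in `ε`, `p`, `q`.
Periodic solutions of these equations are the zeros of a smooth map `scaledMap` of `(ε, p, q, a)`,
built from the periodic solution operator `relax` of `p' = -2p + h`, from the periodic primitive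
`primitive`, and from the solvability condition that the right-hand side of the second equation
has integral zero (`scaledMap_eq_zero_iff`). For `ε = 0` the phase determines `p` and `q`, and the
solvability condition reads `M a = 0` (`period_angularForcing`).

Existence: as `M θ = c sin (θ - θ₁)`, where `c ≠ 0` exactly because the two resonances are excluded
(`M_coefficients_ne_zero`, which rests on `I_eq_pi`), the zeros of `M` are simple. Hence the partial
derivative of `scaledMap` in `(p, q, a)` is triangular and invertible there, and the implicit
function theorem gives one branch of solutions through each zero, unique in a neighbourhood
(`exists_branch`).

Uniqueness near the whole circle: a periodic solution starting near the circle has `|y|² - 1 = O(ε)`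
at the extrema of `|y|²`, hence everywhere, so its scaled coordinates are bounded independently of
`ε` (`IsPeriodicSolution.exists_scaled`). Then `M a = O(ε)`, so that the phase is close to a zero of
`M` and the solution lies in one of the two neighbourhoods above
(`exists_forall_exists_scaled_mem`).
-/

namespace ForcedPlanar

/-! ### The saturation function and the zeros of the bifurcation function -/

theorem sat_eq_max_min (x : ℝ) : sat x = max (-1) (min x 1) := by
  unfold sat
  split_ifs with h1 h2
  · rw [min_eq_left (by linarith), max_eq_left h1.le]
  · rw [min_eq_left h2, max_eq_right (by linarith)]
  · rw [min_eq_right (by linarith), max_eq_right (by norm_num)]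

theorem continuous_sat : Continuous sat := by
  have : sat = fun x => max (-1) (min x 1) := funext sat_eq_max_min
  rw [this]
  fun_prop

theorem abs_sat_le (x : ℝ) : |sat x| ≤ 1 := by
  rw [sat_eq_max_min, abs_le]
  exact ⟨le_max_left _ _, max_le (by norm_num) (min_le_right _ _)⟩

theorem monotone_sat : Monotone sat := by
  intro x y h
  simp only [sat_eq_max_min]
  exact max_le_max le_rfl (min_le_min h le_rfl)

theorem sat_of_abs_le {x : ℝ} (h : |x| ≤ 1) : sat x = x := by
  rw [abs_le] at h
  rw [sat_eq_max_min, min_eq_left h.2, max_eq_right h.1]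

theorem sat_neg (x : ℝ) : sat (-x) = -sat x := by
  rcases lt_or_ge x (-1) with h | h
  · simp only [sat]
    split_ifs <;> linarith
  · simp only [sat]
    split_ifs <;> linarith

theorem integral_sin_sq_zero_two_pi :
    ∫ t in (0 : ℝ)..(2 * Real.pi), Real.sin t * Real.sin t = Real.pi := by
  simp [← pow_two]

theorem mul_sat_mul_mono {s k k' : ℝ} (h : k ≤ k') : s * sat (k * s) ≤ s * sat (k' * s) := by
  rcases le_total 0 s with hs | hs
  · exact mul_le_mul_of_nonneg_left (monotone_sat (mul_le_mul_of_nonneg_right h hs)) hs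
  · exact mul_le_mul_of_nonpos_left (monotone_sat (mul_le_mul_of_nonpos_right h hs)) hs

theorem I_one : I 1 = Real.pi := by
  rw [← integral_sin_sq_zero_two_pi, I]
  congr 1
  ext t
  rw [one_mul, sat_of_abs_le (Real.abs_sin_le_one t)]

theorem I_lt_I {k k' t : ℝ} (h : k ≤ k') (ht : t ∈ Icc 0 (2 * Real.pi))
    (hlt : Real.sin t * sat (k * Real.sin t) < Real.sin t * sat (k' * Real.sin t)) :
    I k < I k' := by
  have hc (k : ℝ) : Continuous fun t => Real.sin t * sat (k * Real.sin t) :=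
    Real.continuous_sin.mul (continuous_sat.comp (by fun_prop))
  exact intervalIntegral.integral_lt_integral_of_continuousOn_of_le_of_exists_lt
    Real.two_pi_pos (hc k).continuousOn (hc k').continuousOn (fun _ _ => mul_sat_mul_mono h)
    ⟨t, ht, hlt⟩

/-- The integrand of `I` is monotone in `k`, and for `k ≠ 1` it differs from `sin² t`, its value at
`k = 1`, at some point. -/
theorem I_eq_pi {k : ℝ} (h : I k = Real.pi) : k = 1 := by
  have hpi := Real.pi_pos
  rcases lt_trichotomy k 1 with hk | hk | hk
  · refine absurd (I_lt_I (t := Real.pi / 2) hk.le ⟨by positivity, by linarith⟩ ?_)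
      (by rw [h, I_one]; exact lt_irrefl _)
    have h1 : sat 1 = 1 := sat_of_abs_le (by norm_num)
    simp only [Real.sin_pi_div_two, mul_one, one_mul, h1]
    rw [sat_eq_max_min]
    exact max_lt (by norm_num) (lt_of_le_of_lt (min_le_left _ _) hk)
  · exact hk
  · -- the strict inequality is tested where `sin t = 1 / k`
    have hk0 : 0 < k := by linarith
    have hinv : k⁻¹ < 1 := inv_lt_one_of_one_lt₀ hk
    have hinv0 : 0 < k⁻¹ := by positivity
    refine absurd (I_lt_I (t := Real.arcsin k⁻¹) hk.le
      ⟨Real.arcsin_nonneg.2 hinv0.le, (Real.arcsin_le_pi_div_two _).trans (by linarith)⟩ ?_)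
      (by rw [h, I_one]; exact lt_irrefl _)
    rw [Real.sin_arcsin (by linarith) hinv.le, mul_inv_cancel₀ hk0.ne', one_mul,
      sat_of_abs_le (x := 1) (by norm_num), sat_of_abs_le (by rw [abs_of_pos hinv0]; exact hinv.le)]
    exact mul_lt_mul_of_pos_left hinv hinv0

theorem I_neg (k : ℝ) : I (-k) = -I k := by
  simp only [I, neg_mul, sat_neg, mul_neg, intervalIntegral.integral_neg]

/-- The two excluded resonances are exactly the parameters for which `M` vanishes identically. -/
theorem M_coefficients_ne_zero {k η : ℝ}
    (h₁ : ¬ (k = 1 ∧ ∃ n : ℤ, η = Real.pi + 2 * Real.pi * n))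
    (h₂ : ¬ (k = -1 ∧ ∃ n : ℤ, η = 2 * Real.pi * n)) :
    ¬ (Real.pi + I k * Real.cos η = 0 ∧ I k * Real.sin η = 0) := by
  rintro ⟨hA, hB⟩
  have hI : I k ≠ 0 := fun h => by simp [h] at hA
  have hs : Real.sin η = 0 := (mul_eq_zero.1 hB).resolve_left hI
  rcases Real.sin_eq_zero_iff_cos_eq.1 hs with hc | hc
  · refine h₂ ⟨?_, ?_⟩
    · have : I (-k) = Real.pi := by rw [I_neg]; rw [hc] at hA; linarith
      linarith [I_eq_pi this]
    · obtain ⟨n, hn⟩ := (Real.cos_eq_one_iff η).1 hc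
      exact ⟨n, by rw [← hn]; ring⟩
  · refine h₁ ⟨I_eq_pi (by rw [hc] at hA; linarith), ?_⟩
    obtain ⟨n, hn⟩ := Real.cos_eq_neg_one_iff.1 hc
    exact ⟨n, by rw [← hn]; ring⟩

theorem M_eq (k η θ : ℝ) :
    M k η θ = (Real.pi + I k * Real.cos η) * Real.cos θ + I k * Real.sin η * Real.sin θ := by
  rw [M, Real.cos_sub]
  ring

/-- Amplitude-phase form of a nonzero trigonometric polynomial of degree one, with the phase
normalised to `[0, π)`; the amplitude may be negative. -/
theorem exists_amplitude_phase {A B : ℝ} (h : ¬ (A = 0 ∧ B = 0)) :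
    ∃ c θ₁ : ℝ, c ≠ 0 ∧ θ₁ ∈ Ico 0 Real.pi ∧
      ∀ θ, A * Real.cos θ + B * Real.sin θ = c * Real.sin (θ - θ₁) := by
  set z : ℂ := ⟨B, A⟩ with hz
  have hz0 : z ≠ 0 := by
    intro h0
    have h1 := congrArg Complex.re h0
    have h2 := congrArg Complex.im h0
    simp only [hz, Complex.zero_re, Complex.zero_im] at h1 h2
    exact h ⟨h2, h1⟩
  have hB : ‖z‖ * Real.cos z.arg = B := Complex.norm_mul_cos_arg z
  have hA : ‖z‖ * Real.sin z.arg = A := Complex.norm_mul_sin_arg z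
  have key (θ : ℝ) : A * Real.cos θ + B * Real.sin θ = ‖z‖ * Real.sin (θ + z.arg) := by
    rw [Real.sin_add]
    linear_combination -Real.sin θ * hB - Real.cos θ * hA
  -- shift the phase `-arg z` into `[0, π)` by a multiple of `π`, which may flip the sign
  have hmem := toIcoMod_mem_Ico Real.pi_pos 0 (-z.arg)
  have hn := self_sub_toIcoDiv_zsmul Real.pi_pos 0 (-z.arg)
  set n := toIcoDiv Real.pi_pos 0 (-z.arg)
  refine ⟨‖z‖ * (-1) ^ n, toIcoMod Real.pi_pos 0 (-z.arg),
    mul_ne_zero (norm_ne_zero_iff.2 hz0) (zpow_ne_zero _ (by norm_num)),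
    by simpa using hmem, fun θ => ?_⟩
  rw [key, ← hn, zsmul_eq_mul,
    show θ - (-z.arg - n * Real.pi) = (θ + z.arg) + n * Real.pi by ring, Real.sin_add_int_mul_pi]
  have : ((-1 : ℝ) ^ n) * (-1) ^ n = 1 := by
    rw [← mul_zpow]; norm_num
  linear_combination (-‖z‖ * Real.sin (θ + z.arg)) * this

theorem setOf_mul_sin_sub_eq_zero {c θ₁ : ℝ} (hc : c ≠ 0) (h : θ₁ ∈ Ico 0 Real.pi) :
    {θ : ℝ | θ ∈ Ico 0 (2 * Real.pi) ∧ c * Real.sin (θ - θ₁) = 0} = {θ₁, θ₁ + Real.pi} := by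
  have hpi := Real.pi_pos
  obtain ⟨h0, h1⟩ := h
  ext θ
  simp only [mem_ofPred_eq, mem_Ico, mem_insert_iff, mem_singleton_iff, mul_eq_zero, hc, false_or]
  constructor
  · rintro ⟨⟨ha, hb⟩, hs⟩
    obtain ⟨n, hn⟩ := Real.sin_eq_zero_iff.1 hs
    have hn1 : (-1 : ℝ) < n := by
      by_contra! hcon
      nlinarith
    have hn2 : (n : ℝ) < 2 := by
      by_contra! hcon
      nlinarith
    have hn1' : -1 < n := by exact_mod_cast hn1
    have hn2' : n < 2 := by exact_mod_cast hn2
    obtain rfl | rfl : n = 0 ∨ n = 1 := by omega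
    · left; push_cast at hn; linarith
    · right; push_cast at hn; linarith
  · rintro (rfl | rfl)
    · exact ⟨⟨h0, by linarith⟩, by simp⟩
    · exact ⟨⟨by linarith, by linarith⟩, by simp⟩

/-- Small values of `c sin (a - θ₁)` force `a` to be close, modulo `2π`, to one of the two zeros. -/
theorem exists_near_zero_of_abs_mul_sin_lt {c θ₁ ρ : ℝ} (hc : c ≠ 0) (hρ : 0 < ρ) :
    ∃ κ > 0, ∀ a : ℝ, |c * Real.sin (a - θ₁)| < κ →
      ∃ m : ℤ, |a + m * (2 * Real.pi) - θ₁| < ρ ∨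
        |a + m * (2 * Real.pi) - (θ₁ + Real.pi)| < ρ := by
  have hpi := Real.pi_pos
  have hc' : 0 < |c| := abs_pos.2 hc
  refine ⟨|c| * (2 / Real.pi * ρ), by positivity, fun a ha => ?_⟩
  set n : ℤ := round ((a - θ₁) / Real.pi) with hn
  set x := a - θ₁ - n * Real.pi with hx
  have hx2 : |x| ≤ Real.pi / 2 := by
    have h1 := abs_sub_round ((a - θ₁) / Real.pi)
    rw [← hn] at h1
    have h2 : x = ((a - θ₁) / Real.pi - n) * Real.pi := by rw [hx]; field_simp
    rw [h2, abs_mul, abs_of_pos hpi]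
    nlinarith
  have hs : |Real.sin x| = |Real.sin (a - θ₁)| := by
    rw [hx, Real.sin_sub_int_mul_pi, abs_mul, abs_zpow]
    simp
  have hlt : |x| < ρ := by
    rw [abs_mul, mul_lt_mul_iff_right₀ hc', ← hs] at ha
    have := (Real.mul_abs_le_abs_sin hx2).trans_lt ha
    exact (mul_lt_mul_iff_right₀ (by positivity)).1 this
  rcases Int.even_or_odd' n with ⟨j, hj | hj⟩
  · refine ⟨-j, Or.inl ?_⟩
    convert hlt using 2
    rw [hx, hj]; push_cast; ring
  · refine ⟨-j, Or.inr ?_⟩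
    convert hlt using 2
    rw [hx, hj]; push_cast; ring

/-! ### Periodic functions and integral operators on them -/

instance fact_two_pi_pos : Fact (0 < 2 * Real.pi) := ⟨Real.two_pi_pos⟩

/-- The Banach algebra of continuous `2π`-periodic real functions, realised as the continuous
functions on the circle `ℝ / 2πℤ`. -/
abbrev PerFun : Type := C(AddCircle (2 * Real.pi), ℝ)

namespace PerFun

/-- The element of `PerFun` given by a continuous `2π`-periodic function on the line. -/
noncomputable def ofPeriodic (g : ℝ → ℝ) (hg : Continuous g) (hp : Function.Periodic g (2 * Real.pi)) :
    PerFun :=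
  ⟨hp.lift, continuous_quot_lift _ hg⟩

@[simp]
theorem ofPeriodic_coe (g : ℝ → ℝ) (hg : Continuous g) (hp : Function.Periodic g (2 * Real.pi))
    (t : ℝ) : ofPeriodic g hg hp (t : AddCircle (2 * Real.pi)) = g t :=
  rfl

theorem periodic_coe (h : PerFun) :
    Function.Periodic (fun t : ℝ => h (t : AddCircle (2 * Real.pi))) (2 * Real.pi) := by
  intro t
  simp

@[fun_prop]
theorem continuous_coe (h : PerFun) :
    Continuous fun t : ℝ => h (t : AddCircle (2 * Real.pi)) :=
  h.continuous.comp (AddCircle.continuous_mk' _)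

theorem ext_coe {g h : PerFun}
    (H : ∀ t : ℝ, g (t : AddCircle (2 * Real.pi)) = h (t : AddCircle (2 * Real.pi))) : g = h := by
  ext x
  obtain ⟨t, rfl⟩ := QuotientAddGroup.mk_surjective x
  exact H t

theorem norm_le_of_coe {h : PerFun} {C : ℝ} (hC : 0 ≤ C)
    (H : ∀ t : ℝ, |h (t : AddCircle (2 * Real.pi))| ≤ C) : ‖h‖ ≤ C := by
  rw [ContinuousMap.norm_le _ hC]
  intro x
  obtain ⟨t, rfl⟩ := QuotientAddGroup.mk_surjective x
  exact H t

theorem norm_le_of_forall_Icc {h : PerFun} {C : ℝ} (hC : 0 ≤ C)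
    (H : ∀ t ∈ Icc 0 (2 * Real.pi), |h (t : AddCircle (2 * Real.pi))| ≤ C) : ‖h‖ ≤ C := by
  refine norm_le_of_coe hC fun t => ?_
  obtain ⟨s, hs, hst⟩ := (periodic_coe h).exists_mem_Ico₀ Real.two_pi_pos t
  rw [show h (t : AddCircle (2 * Real.pi)) = h (s : AddCircle (2 * Real.pi)) from hst]
  exact H s (Ico_subset_Icc_self hs)

theorem abs_coe_le_norm (h : PerFun) (t : ℝ) :
    |h (t : AddCircle (2 * Real.pi))| ≤ ‖h‖ :=
  h.norm_coe_le_norm _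

/-- The integral of a periodic function over one period. -/
noncomputable def period : PerFun →L[ℝ] ℝ :=
  LinearMap.mkContinuous
    { toFun := fun h => ∫ s in (0 : ℝ)..(2 * Real.pi), h (s : AddCircle (2 * Real.pi))
      map_add' := fun g h => by
        simp only [ContinuousMap.add_apply]
        exact intervalIntegral.integral_add ((continuous_coe g).intervalIntegrable _ _)
          ((continuous_coe h).intervalIntegrable _ _)
      map_smul' := fun c h => by
        simp [intervalIntegral.integral_const_mul] }
    (2 * Real.pi) fun h => by
      have := intervalIntegral.norm_integral_le_of_norm_le_const (a := 0) (b := 2 * Real.pi)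
        (f := fun s : ℝ => h (s : AddCircle (2 * Real.pi))) fun s _ => abs_coe_le_norm h s
      rw [sub_zero, abs_of_pos Real.two_pi_pos] at this
      exact this.trans_eq (mul_comm _ _)

theorem period_apply (h : PerFun) :
    period h = ∫ s in (0 : ℝ)..(2 * Real.pi), h (s : AddCircle (2 * Real.pi)) :=
  rfl

theorem primitive_periodic (h : PerFun) :
    Function.Periodic (fun t : ℝ => (∫ s in (0 : ℝ)..t, h (s : AddCircle (2 * Real.pi)))
      - t / (2 * Real.pi) * period h) (2 * Real.pi) := by
  intro t
  have h1 := (periodic_coe h).intervalIntegral_add_eq_add 0 t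
    fun a b => (continuous_coe h).intervalIntegrable a b
  simp only [zero_add] at h1
  simp only [period_apply]
  rw [h1]
  have := Real.pi_pos
  field_simp
  ring

/-- The periodic primitive, vanishing at `0`, of a periodic function minus its mean. -/
noncomputable def primitive : PerFun →L[ℝ] PerFun :=
  LinearMap.mkContinuous
    { toFun := fun h => ofPeriodic
        (fun t : ℝ => (∫ s in (0 : ℝ)..t, h (s : AddCircle (2 * Real.pi)))
          - t / (2 * Real.pi) * period h)
        ((intervalIntegral.continuous_primitive
          (fun a b => (continuous_coe h).intervalIntegrable a b) 0).sub (by fun_prop))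
        (primitive_periodic h)
      map_add' := fun g h => ext_coe fun t => by
        simp only [ofPeriodic_coe, ContinuousMap.add_apply, map_add]
        rw [intervalIntegral.integral_add ((continuous_coe g).intervalIntegrable _ _)
          ((continuous_coe h).intervalIntegrable _ _)]
        ring
      map_smul' := fun c h => ext_coe fun t => by
        simp only [ofPeriodic_coe, ContinuousMap.smul_apply, map_smul, smul_eq_mul,
          intervalIntegral.integral_const_mul, RingHom.id_apply]
        ring }
    (2 * Real.pi + ‖period‖) fun h => by
      have hpi := Real.two_pi_pos
      refine norm_le_of_forall_Icc (by positivity) fun t ht => ?_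
      have h1 := intervalIntegral.norm_integral_le_of_norm_le_const (a := 0) (b := t)
        (f := fun s : ℝ => h (s : AddCircle (2 * Real.pi))) fun s _ => abs_coe_le_norm h s
      rw [sub_zero, abs_of_nonneg ht.1, Real.norm_eq_abs] at h1
      have h2 : |t / (2 * Real.pi) * period h| ≤ 1 * (‖period‖ * ‖h‖) := by
        rw [abs_mul]
        refine mul_le_mul ?_ (period.le_opNorm h) (abs_nonneg _) zero_le_one
        rw [abs_of_nonneg (div_nonneg ht.1 hpi.le), div_le_one hpi]
        exact ht.2
      have h3 : ‖h‖ * t ≤ ‖h‖ * (2 * Real.pi) := mul_le_mul_of_nonneg_left ht.2 (norm_nonneg _)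
      change |(∫ s in (0 : ℝ)..t, h (s : AddCircle (2 * Real.pi)))
          - t / (2 * Real.pi) * period h| ≤ _
      refine (abs_sub _ _).trans ?_
      linarith

theorem primitive_coe (h : PerFun) (t : ℝ) :
    primitive h (t : AddCircle (2 * Real.pi)) =
      (∫ s in (0 : ℝ)..t, h (s : AddCircle (2 * Real.pi))) - t / (2 * Real.pi) * period h :=
  rfl

theorem hasDerivAt_primitive {h : PerFun} (h0 : period h = 0) (t : ℝ) :
    HasDerivAt (fun t : ℝ => primitive h (t : AddCircle (2 * Real.pi)))
      (h (t : AddCircle (2 * Real.pi))) t := by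
  simp only [primitive_coe, h0, mul_zero, sub_zero]
  exact (continuous_coe h).integral_hasStrictDerivAt 0 t |>.hasDerivAt

theorem period_eq_zero_of_hasDerivAt {q h : PerFun}
    (hq : ∀ t : ℝ, HasDerivAt (fun t : ℝ => q (t : AddCircle (2 * Real.pi)))
      (h (t : AddCircle (2 * Real.pi))) t) : period h = 0 := by
  rw [period_apply, intervalIntegral.integral_eq_sub_of_hasDerivAt (fun t _ => hq t)
    ((continuous_coe h).intervalIntegrable _ _)]
  have := periodic_coe q 0
  simp only [zero_add] at this
  rw [this, sub_self]

theorem eq_primitive_of_hasDerivAt {q h : PerFun}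
    (hq : ∀ t : ℝ, HasDerivAt (fun t : ℝ => q (t : AddCircle (2 * Real.pi)))
      (h (t : AddCircle (2 * Real.pi))) t)
    (h0 : q ((0 : ℝ) : AddCircle (2 * Real.pi)) = 0) : q = primitive h := by
  refine ext_coe fun t => ?_
  rw [primitive_coe, period_eq_zero_of_hasDerivAt hq, mul_zero, sub_zero,
    intervalIntegral.integral_eq_sub_of_hasDerivAt (fun t _ => hq t)
    ((continuous_coe h).intervalIntegrable _ _), h0, sub_zero]

/-- The normalising factor of the Green function of `p' = -2p + h` on the circle. -/
noncomputable def relaxFactor : ℝ := (1 - Real.exp (-(4 * Real.pi)))⁻¹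

theorem one_sub_exp_pos : 0 < 1 - Real.exp (-(4 * Real.pi)) := by
  have : Real.exp (-(4 * Real.pi)) < 1 := Real.exp_lt_one_iff.2 (by linarith [Real.pi_pos])
  linarith

theorem relaxFactor_pos : 0 < relaxFactor := inv_pos.2 one_sub_exp_pos

theorem continuous_exp_mul_coe (h : PerFun) :
    Continuous fun s : ℝ => Real.exp (2 * s) * h (s : AddCircle (2 * Real.pi)) := by
  fun_prop

theorem hasDerivAt_relaxKernel (h : PerFun) (t : ℝ) :
    HasDerivAt (fun t : ℝ => relaxFactor * Real.exp (-(2 * t)) *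
      ∫ s in (t - 2 * Real.pi)..t, Real.exp (2 * s) * h (s : AddCircle (2 * Real.pi)))
      (-2 * (relaxFactor * Real.exp (-(2 * t)) *
      ∫ s in (t - 2 * Real.pi)..t, Real.exp (2 * s) * h (s : AddCircle (2 * Real.pi)))
        + h (t : AddCircle (2 * Real.pi))) t := by
  have hc := continuous_exp_mul_coe h
  set A : ℝ → ℝ := fun t => ∫ s in (0 : ℝ)..t, Real.exp (2 * s) * h (s : AddCircle (2 * Real.pi))
    with hA
  have hAd (t : ℝ) : HasDerivAt A (Real.exp (2 * t) * h (t : AddCircle (2 * Real.pi))) t :=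
    (hc.integral_hasStrictDerivAt 0 t).hasDerivAt
  have heq (t : ℝ) : (∫ s in (t - 2 * Real.pi)..t,
      Real.exp (2 * s) * h (s : AddCircle (2 * Real.pi))) = A t - A (t - 2 * Real.pi) :=
    (intervalIntegral.integral_interval_sub_left (hc.intervalIntegrable _ _)
      (hc.intervalIntegrable _ _)).symm
  simp only [heq]
  have hper : h ((t - 2 * Real.pi : ℝ) : AddCircle (2 * Real.pi)) =
      h (t : AddCircle (2 * Real.pi)) := (periodic_coe h).sub_eq t
  have h2 := (hAd (t - 2 * Real.pi)).comp_sub_const t (2 * Real.pi)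
  rw [hper] at h2
  have he : HasDerivAt (fun t : ℝ => relaxFactor * Real.exp (-(2 * t)))
      (relaxFactor * (Real.exp (-(2 * t)) * (-(2 * 1)))) t :=
    (((hasDerivAt_id t).const_mul 2).neg.exp).const_mul _
  refine (he.mul ((hAd t).sub h2)).congr_deriv ?_
  have e1 : Real.exp (-(2 * t)) * Real.exp (2 * t) = 1 := by
    rw [← Real.exp_add]; simp
  have e2 : Real.exp (-(2 * t)) * Real.exp (2 * (t - 2 * Real.pi)) =
      Real.exp (-(4 * Real.pi)) := by
    rw [← Real.exp_add]; congr 1; ring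
  have e3 : relaxFactor * (1 - Real.exp (-(4 * Real.pi))) = 1 :=
    inv_mul_cancel₀ one_sub_exp_pos.ne'
  simp only [Pi.sub_apply]
  linear_combination h (t : AddCircle (2 * Real.pi)) * (relaxFactor * e1 - relaxFactor * e2 + e3)

theorem relaxKernel_periodic (h : PerFun) :
    Function.Periodic (fun t : ℝ => relaxFactor * Real.exp (-(2 * t)) *
      ∫ s in (t - 2 * Real.pi)..t, Real.exp (2 * s) * h (s : AddCircle (2 * Real.pi)))
      (2 * Real.pi) := by
  intro t
  have h1 : (∫ s in (t + 2 * Real.pi - 2 * Real.pi)..(t + 2 * Real.pi),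
      Real.exp (2 * s) * h (s : AddCircle (2 * Real.pi))) =
      Real.exp (2 * (2 * Real.pi)) * ∫ s in (t - 2 * Real.pi)..t,
        Real.exp (2 * s) * h (s : AddCircle (2 * Real.pi)) := by
    rw [← intervalIntegral.integral_const_mul,
      show t + 2 * Real.pi - 2 * Real.pi = t - 2 * Real.pi + 2 * Real.pi by ring,
      ← intervalIntegral.integral_comp_add_right]
    congr 1
    ext s
    have := periodic_coe h s
    simp only at this
    rw [this, mul_add, Real.exp_add]
    ring
  simp only [h1]
  have : Real.exp (-(2 * (t + 2 * Real.pi))) * Real.exp (2 * (2 * Real.pi)) =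
      Real.exp (-(2 * t)) := by
    rw [← Real.exp_add]; congr 1; ring
  linear_combination (relaxFactor * ∫ s in (t - 2 * Real.pi)..t,
        Real.exp (2 * s) * h (s : AddCircle (2 * Real.pi))) * this

/-- The solution operator `h ↦ p` of the relaxation equation `p' = -2p + h` on the circle. -/
noncomputable def relax : PerFun →L[ℝ] PerFun :=
  LinearMap.mkContinuous
    { toFun := fun h => ofPeriodic
        (fun t : ℝ => relaxFactor * Real.exp (-(2 * t)) *
          ∫ s in (t - 2 * Real.pi)..t, Real.exp (2 * s) * h (s : AddCircle (2 * Real.pi)))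
        (continuous_iff_continuousAt.2 fun t => (hasDerivAt_relaxKernel h t).continuousAt)
        (relaxKernel_periodic h)
      map_add' := fun g h => ext_coe fun t => by
        simp only [ofPeriodic_coe, ContinuousMap.add_apply, mul_add]
        rw [intervalIntegral.integral_add
          ((continuous_exp_mul_coe g).intervalIntegrable _ _)
          ((continuous_exp_mul_coe h).intervalIntegrable _ _)]
        ring
      map_smul' := fun c h => ext_coe fun t => by
        simp only [ofPeriodic_coe, ContinuousMap.smul_apply, smul_eq_mul,
          mul_left_comm _ c, intervalIntegral.integral_const_mul, RingHom.id_apply] }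
    (relaxFactor * (2 * Real.pi)) fun h => by
      have hpi := Real.two_pi_pos
      have hr := relaxFactor_pos
      refine norm_le_of_coe (by positivity) fun t => ?_
      change |relaxFactor * Real.exp (-(2 * t)) *
        ∫ s in (t - 2 * Real.pi)..t, Real.exp (2 * s) * h (s : AddCircle (2 * Real.pi))| ≤ _
      have h1 := intervalIntegral.norm_integral_le_of_norm_le_const (a := t - 2 * Real.pi) (b := t)
        (C := Real.exp (2 * t) * ‖h‖)
        (f := fun s : ℝ => Real.exp (2 * s) * h (s : AddCircle (2 * Real.pi))) fun s hs => by
          rw [uIoc_of_le (by linarith)] at hs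
          rw [norm_mul, Real.norm_eq_abs, Real.abs_exp]
          exact mul_le_mul (Real.exp_le_exp.2 (by linarith [hs.2])) (abs_coe_le_norm h s)
            (norm_nonneg _) (Real.exp_nonneg _)
      rw [sub_sub_cancel, abs_of_pos hpi, Real.norm_eq_abs] at h1
      rw [abs_mul, abs_mul, Real.abs_exp, abs_of_pos hr]
      have e1 : Real.exp (-(2 * t)) * Real.exp (2 * t) = 1 := by
        rw [← Real.exp_add]; simp
      calc _ ≤ relaxFactor * Real.exp (-(2 * t)) * (Real.exp (2 * t) * ‖h‖ * (2 * Real.pi)) := by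
            gcongr
        _ = _ := by linear_combination (relaxFactor * ‖h‖ * (2 * Real.pi)) * e1

theorem relax_coe (h : PerFun) (t : ℝ) :
    relax h (t : AddCircle (2 * Real.pi)) = relaxFactor * Real.exp (-(2 * t)) *
      ∫ s in (t - 2 * Real.pi)..t, Real.exp (2 * s) * h (s : AddCircle (2 * Real.pi)) :=
  rfl

theorem hasDerivAt_relax (h : PerFun) (t : ℝ) :
    HasDerivAt (fun t : ℝ => relax h (t : AddCircle (2 * Real.pi)))
      (-2 * relax h (t : AddCircle (2 * Real.pi)) + h (t : AddCircle (2 * Real.pi))) t :=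
  hasDerivAt_relaxKernel h t

theorem eq_relax_of_hasDerivAt {p h : PerFun}
    (hp : ∀ t : ℝ, HasDerivAt (fun t : ℝ => p (t : AddCircle (2 * Real.pi)))
      (-2 * p (t : AddCircle (2 * Real.pi)) + h (t : AddCircle (2 * Real.pi))) t) :
    p = relax h := by
  refine ext_coe fun t => ?_
  have hd (s : ℝ) : HasDerivAt
      (fun s : ℝ => Real.exp (2 * s) * p (s : AddCircle (2 * Real.pi)))
      (Real.exp (2 * s) * h (s : AddCircle (2 * Real.pi))) s := by
    have he : HasDerivAt (fun s : ℝ => Real.exp (2 * s)) (Real.exp (2 * s) * (2 * 1)) s :=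
      ((hasDerivAt_id s).const_mul 2).exp
    refine (he.mul (hp s)).congr_deriv ?_
    ring
  rw [relax_coe, intervalIntegral.integral_eq_sub_of_hasDerivAt (fun s _ => hd s)
    ((continuous_exp_mul_coe h).intervalIntegrable _ _)]
  have hper : p ((t - 2 * Real.pi : ℝ) : AddCircle (2 * Real.pi)) =
      p (t : AddCircle (2 * Real.pi)) := (periodic_coe p).sub_eq t
  rw [hper]
  have e1 : Real.exp (-(2 * t)) * Real.exp (2 * t) = 1 := by
    rw [← Real.exp_add]; simp
  have e2 : Real.exp (-(2 * t)) * Real.exp (2 * (t - 2 * Real.pi)) =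
      Real.exp (-(4 * Real.pi)) := by
    rw [← Real.exp_add]; congr 1; ring
  have e3 : relaxFactor * (1 - Real.exp (-(4 * Real.pi))) = 1 :=
    inv_mul_cancel₀ one_sub_exp_pos.ne'
  linear_combination -p (t : AddCircle (2 * Real.pi)) * (relaxFactor * e1 - relaxFactor * e2 + e3)

end PerFun

/-! ### The scaled problem as a smooth equation in a Banach space -/

section Scaled

variable (fc fs : PerFun)

/-- The function `t ↦ f(t) cos(t + a)`, where `fc = f cos` and `fs = f sin`. -/
noncomputable def radialForcing (a : ℝ) : PerFun := Real.cos a • fc - Real.sin a • fs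

/-- The function `t ↦ f(t) sin(t + a)`, where `fc = f cos` and `fs = f sin`. -/
noncomputable def angularForcing (a : ℝ) : PerFun := Real.cos a • fs + Real.sin a • fc

/-- The quantity `(|z|² - 1) / ε` for `z` of modulus `|1 + ε (p + i q)|`. -/
noncomputable def radialExcess (ε : ℝ) (p q : PerFun) : PerFun :=
  (2 : ℝ) • p + ε • (p * p + q * q)

/-- The right-hand side of the radial equation `p' = -2p + radialRHS`. -/
noncomputable def radialRHS (v : ℝ × PerFun × PerFun × ℝ) : PerFun :=
  radialForcing fc fs v.2.2.2 -
    v.1 • (v.2.1 * v.2.1 + v.2.2.1 * v.2.2.1 + v.2.1 * radialExcess v.1 v.2.1 v.2.2.1)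

/-- The right-hand side of the angular equation `q' = angularRHS`. -/
noncomputable def angularRHS (v : ℝ × PerFun × PerFun × ℝ) : PerFun :=
  -angularForcing fc fs v.2.2.2 - v.1 • (v.2.2.1 * radialExcess v.1 v.2.1 v.2.2.1)

/-- The map whose zeros `(ε, p, q, a)` are the `2π`-periodic solutions with `q 0 = 0` of
the equations `p' = -2p + radialRHS` and `q' = angularRHS`. -/
noncomputable def scaledMap (v : ℝ × PerFun × PerFun × ℝ) : PerFun × PerFun × ℝ :=
  (v.2.1 - PerFun.relax (radialRHS fc fs v),
   v.2.2.1 - PerFun.primitive (angularRHS fc fs v),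
   PerFun.period (angularRHS fc fs v))

/-- For `ε = 0` the phase `a` determines the other two unknowns. -/
noncomputable def basePoint (a : ℝ) : PerFun × PerFun × ℝ :=
  (PerFun.relax (radialForcing fc fs a), -PerFun.primitive (angularForcing fc fs a), a)

theorem contDiff_scaledMap : ContDiff ℝ 1 (scaledMap fc fs) := by
  unfold scaledMap radialRHS angularRHS radialForcing angularForcing radialExcess
  fun_prop

theorem scaledMap_eq_zero_iff {v : ℝ × PerFun × PerFun × ℝ} :
    scaledMap fc fs v = 0 ↔
      (∀ t : ℝ, HasDerivAt (fun t : ℝ => v.2.1 (t : AddCircle (2 * Real.pi)))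
        (-2 * v.2.1 (t : AddCircle (2 * Real.pi)) +
          radialRHS fc fs v (t : AddCircle (2 * Real.pi))) t) ∧
      (∀ t : ℝ, HasDerivAt (fun t : ℝ => v.2.2.1 (t : AddCircle (2 * Real.pi)))
        (angularRHS fc fs v (t : AddCircle (2 * Real.pi))) t) ∧
      v.2.2.1 ((0 : ℝ) : AddCircle (2 * Real.pi)) = 0 := by
  simp only [scaledMap, Prod.mk_eq_zero, sub_eq_zero]
  constructor
  · rintro ⟨hp, hq, hm⟩
    refine ⟨fun t => ?_, fun t => ?_, ?_⟩
    · have := PerFun.hasDerivAt_relax (radialRHS fc fs v) t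
      rwa [← hp] at this
    · have := PerFun.hasDerivAt_primitive hm t
      rwa [← hq] at this
    · rw [hq, PerFun.primitive_coe]
      simp
  · rintro ⟨hp, hq, h0⟩
    exact ⟨PerFun.eq_relax_of_hasDerivAt hp, PerFun.eq_primitive_of_hasDerivAt hq h0,
      PerFun.period_eq_zero_of_hasDerivAt hq⟩

theorem scaledMap_zero (x : PerFun × PerFun × ℝ) :
    scaledMap fc fs (0, x) =
      (x.1 - PerFun.relax (radialForcing fc fs x.2.2),
       x.2.1 + PerFun.primitive (angularForcing fc fs x.2.2),
       -PerFun.period (angularForcing fc fs x.2.2)) := by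
  simp [scaledMap, radialRHS, angularRHS]

theorem isInvertible_of_triangular {E : Type*} [NormedAddCommGroup E] [NormedSpace ℝ E]
    (u w : E) {d : ℝ} (hd : d ≠ 0) {T : E × E × ℝ →L[ℝ] E × E × ℝ}
    (hT : ∀ x, T x = (x.1 + x.2.2 • u, x.2.1 + x.2.2 • w, x.2.2 * d)) : T.IsInvertible := by
  let S : E × E × ℝ →L[ℝ] E × E × ℝ :=
    (ContinuousLinearMap.fst ℝ E (E × ℝ) - ((d⁻¹ • ContinuousLinearMap.snd ℝ E ℝ).smulRight u).comp
        (ContinuousLinearMap.snd ℝ E (E × ℝ))).prod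
      (((ContinuousLinearMap.fst ℝ E ℝ - (d⁻¹ • ContinuousLinearMap.snd ℝ E ℝ).smulRight w).prod
        (d⁻¹ • ContinuousLinearMap.snd ℝ E ℝ)).comp (ContinuousLinearMap.snd ℝ E (E × ℝ)))
  have hS (x : E × E × ℝ) :
      S x = (x.1 - (d⁻¹ * x.2.2) • u, x.2.1 - (d⁻¹ * x.2.2) • w, d⁻¹ * x.2.2) := by
    simp [S]
  refine ⟨ContinuousLinearEquiv.equivOfInverse T S (fun x => ?_) fun x => ?_, ?_⟩
  · have : d⁻¹ * (x.2.2 * d) = x.2.2 := by field_simp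
    rw [hS, hT]
    simp [this]
  · have : d⁻¹ * x.2.2 * d = x.2.2 := by field_simp
    rw [hT, hS]
    simp [this]
  · ext x <;> rfl

theorem hasFDerivAt_scaledMap_zero (x : PerFun × PerFun × ℝ) :
    HasFDerivAt (fun x => scaledMap fc fs (0, x))
      ((ContinuousLinearMap.fst ℝ PerFun (PerFun × ℝ) +
          ((ContinuousLinearMap.snd ℝ PerFun ℝ).comp
            (ContinuousLinearMap.snd ℝ PerFun (PerFun × ℝ))).smulRight
            (PerFun.relax (angularForcing fc fs x.2.2))).prod
        (((ContinuousLinearMap.fst ℝ PerFun ℝ).comp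
            (ContinuousLinearMap.snd ℝ PerFun (PerFun × ℝ)) +
          ((ContinuousLinearMap.snd ℝ PerFun ℝ).comp
            (ContinuousLinearMap.snd ℝ PerFun (PerFun × ℝ))).smulRight
            (PerFun.primitive (radialForcing fc fs x.2.2))).prod
          (((ContinuousLinearMap.snd ℝ PerFun ℝ).comp
            (ContinuousLinearMap.snd ℝ PerFun (PerFun × ℝ))).smulRight
            (-PerFun.period (radialForcing fc fs x.2.2))))) x := by
  have hphase : HasFDerivAt (fun x : PerFun × PerFun × ℝ => x.2.2)
      ((ContinuousLinearMap.snd ℝ PerFun ℝ).comp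
        (ContinuousLinearMap.snd ℝ PerFun (PerFun × ℝ))) x :=
    hasFDerivAt_snd.comp x hasFDerivAt_snd
  have hr (a : ℝ) : HasDerivAt (radialForcing fc fs) (-angularForcing fc fs a) a := by
    refine (((Real.hasDerivAt_cos a).smul_const fc).sub
      ((Real.hasDerivAt_sin a).smul_const fs)).congr_deriv ?_
    simp only [angularForcing, neg_smul]
    abel
  have ha (a : ℝ) : HasDerivAt (angularForcing fc fs) (radialForcing fc fs a) a := by
    refine (((Real.hasDerivAt_cos a).smul_const fs).add
      ((Real.hasDerivAt_sin a).smul_const fc)).congr_deriv ?_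
    simp only [radialForcing, neg_smul]
    abel
  have hr' := (hr x.2.2).hasFDerivAt.comp x hphase
  have ha' := (ha x.2.2).hasFDerivAt.comp x hphase
  have h1 := (hasFDerivAt_fst (𝕜 := ℝ) (p := x)).sub (PerFun.relax.hasFDerivAt.comp x hr')
  have h2 := ((hasFDerivAt_fst (𝕜 := ℝ)).comp x hasFDerivAt_snd).add
    (PerFun.primitive.hasFDerivAt.comp x ha')
  have h3 := (PerFun.period.hasFDerivAt.comp x ha').neg
  simp only [scaledMap_zero]
  refine (h1.prodMk (h2.prodMk h3)).congr_fderiv ?_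
  ext x <;> simp

/-- The implicit function theorem at a simple zero of the averaged equation: for small `ε` there
is exactly one solution of the scaled problem near the base point. -/
theorem exists_branch {θ : ℝ} (h0 : PerFun.period (angularForcing fc fs θ) = 0)
    (h1 : PerFun.period (radialForcing fc fs θ) ≠ 0) :
    ∃ ψ : ℝ → PerFun × PerFun × ℝ,
      Tendsto ψ (𝓝 0) (𝓝 (basePoint fc fs θ)) ∧
      (∀ᶠ ε in 𝓝 0, scaledMap fc fs (ε, ψ ε) = 0) ∧
      ∀ᶠ v in 𝓝 ((0 : ℝ), basePoint fc fs θ), scaledMap fc fs v = 0 → ψ v.1 = v.2 := by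
  set u : ℝ × PerFun × PerFun × ℝ := (0, basePoint fc fs θ) with hu
  have hF0 : scaledMap fc fs u = 0 := by
    rw [hu, scaledMap_zero]
    simp [basePoint, h0]
  have hs : HasStrictFDerivAt (scaledMap fc fs) (fderiv ℝ (scaledMap fc fs) u) u :=
    (contDiff_scaledMap fc fs).contDiffAt.hasStrictFDerivAt one_ne_zero
  have hpart : fderiv ℝ (scaledMap fc fs) u ∘L .inr ℝ ℝ (PerFun × PerFun × ℝ) = _ :=
    (hs.hasFDerivAt.comp (basePoint fc fs θ)
      (hasFDerivAt_prodMk_right (0 : ℝ) (basePoint fc fs θ))).unique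
        (hasFDerivAt_scaledMap_zero fc fs (basePoint fc fs θ))
  have hinv : (fderiv ℝ (scaledMap fc fs) u ∘L .inr ℝ ℝ (PerFun × PerFun × ℝ)).IsInvertible := by
    rw [hpart]
    exact isInvertible_of_triangular _ _ (neg_ne_zero.2 h1) fun x => rfl
  refine ⟨hs.implicitFunctionOfProdDomain hinv, hs.tendsto_implicitFunctionOfProdDomain hinv,
    ?_, ?_⟩
  · have := hs.eventually_apply_implicitFunctionOfProdDomain hinv
    rwa [hF0] at this
  · have := hs.eventually_apply_eq_iff_implicitFunctionOfProdDomain hinv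
    rw [hF0] at this
    exact this.mono fun v hv h => hv.1 h

theorem continuous_basePoint : Continuous (basePoint fc fs) := by
  unfold basePoint radialForcing angularForcing
  fun_prop

end Scaled

/-! ### The forcing term and its averages -/

/-- The forcing term `f(t) = sin t + φ(k sin (t + η))`. -/
noncomputable def forcing (k η t : ℝ) : ℝ := Real.sin t + sat (k * Real.sin (t + η))

theorem continuous_forcing (k η : ℝ) : Continuous (forcing k η) :=
  Real.continuous_sin.add (continuous_sat.comp (by fun_prop))

theorem forcing_periodic (k η : ℝ) : Function.Periodic (forcing k η) (2 * Real.pi) := by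
  intro t
  rw [forcing, forcing, Real.sin_add_two_pi, add_right_comm, Real.sin_add_two_pi]

theorem abs_forcing_le (k η t : ℝ) : |forcing k η t| ≤ 2 := by
  have h1 := Real.abs_sin_le_one t
  have h2 := abs_sat_le (k * Real.sin (t + η))
  exact (abs_add_le _ _).trans (by linarith)

/-- The function `f cos`. -/
noncomputable def forcingCos (k η : ℝ) : PerFun :=
  PerFun.ofPeriodic (fun t => forcing k η t * Real.cos t)
    ((continuous_forcing k η).mul Real.continuous_cos)
    ((forcing_periodic k η).mul Real.cos_periodic)

/-- The function `f sin`. -/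
noncomputable def forcingSin (k η : ℝ) : PerFun :=
  PerFun.ofPeriodic (fun t => forcing k η t * Real.sin t)
    ((continuous_forcing k η).mul Real.continuous_sin)
    ((forcing_periodic k η).mul Real.sin_periodic)

theorem radialForcing_coe (k η a t : ℝ) :
    radialForcing (forcingCos k η) (forcingSin k η) a (t : AddCircle (2 * Real.pi)) =
      forcing k η t * Real.cos (t + a) := by
  simp only [radialForcing, forcingCos, forcingSin, ContinuousMap.sub_apply,
    ContinuousMap.smul_apply, PerFun.ofPeriodic_coe, smul_eq_mul, Real.cos_add]
  ring

theorem angularForcing_coe (k η a t : ℝ) :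
    angularForcing (forcingCos k η) (forcingSin k η) a (t : AddCircle (2 * Real.pi)) =
      forcing k η t * Real.sin (t + a) := by
  simp only [angularForcing, forcingCos, forcingSin, ContinuousMap.add_apply,
    ContinuousMap.smul_apply, PerFun.ofPeriodic_coe, smul_eq_mul, Real.sin_add]
  ring

/-- The `cos`-component of `h (sin s)` has zero mean, being the derivative of a function of
`sin s`. -/
theorem integral_comp_sin_mul_sin_add {h : ℝ → ℝ} (hh : Continuous h) (β : ℝ) :
    ∫ s in (0 : ℝ)..(2 * Real.pi), h (Real.sin s) * Real.sin (s + β) =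
      Real.cos β * ∫ s in (0 : ℝ)..(2 * Real.pi), Real.sin s * h (Real.sin s) := by
  have hc : Continuous fun s => h (Real.sin s) := hh.comp Real.continuous_sin
  have h0 : ∫ s in (0 : ℝ)..(2 * Real.pi), h (Real.sin s) * Real.cos s = 0 := by
    have := intervalIntegral.integral_comp_mul_deriv (a := 0) (b := 2 * Real.pi)
      (fun s _ => Real.hasDerivAt_sin s) Real.continuous_cos.continuousOn hh
    simpa using this
  have he (s : ℝ) : h (Real.sin s) * Real.sin (s + β) =
      Real.cos β * (Real.sin s * h (Real.sin s)) +
        Real.sin β * (h (Real.sin s) * Real.cos s) := by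
    rw [Real.sin_add]; ring
  simp only [he]
  rw [intervalIntegral.integral_add, intervalIntegral.integral_const_mul,
    intervalIntegral.integral_const_mul, h0, mul_zero, add_zero]
  · exact Continuous.intervalIntegrable (by fun_prop) _ _
  · exact Continuous.intervalIntegrable (by fun_prop) _ _

/-- `M` is the average of the angular forcing. -/
theorem period_angularForcing (k η θ : ℝ) :
    PerFun.period (angularForcing (forcingCos k η) (forcingSin k η) θ) = M k η θ := by
  have hs : Continuous fun s => sat (k * s) := continuous_sat.comp (by fun_prop)
  have hs' : Continuous fun t => sat (k * Real.sin (t + η)) * Real.sin (t + θ) :=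
    (continuous_sat.comp (by fun_prop)).mul (by fun_prop)
  rw [PerFun.period_apply]
  simp only [angularForcing_coe, forcing, add_mul]
  rw [intervalIntegral.integral_add (Continuous.intervalIntegrable (by fun_prop) _ _)
    (hs'.intervalIntegrable _ _)]
  have h1 := integral_comp_sin_mul_sin_add (h := fun s => s) continuous_id θ
  rw [h1, integral_sin_sq_zero_two_pi]
  have h2 := integral_comp_sin_mul_sin_add hs (θ - η)
  have hper : Function.Periodic (fun s => sat (k * Real.sin s) * Real.sin (s + (θ - η)))
      (2 * Real.pi) := by
    intro s
    simp only
    rw [Real.sin_add_two_pi, add_right_comm, Real.sin_add_two_pi]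
  have h3 : ∫ t in (0 : ℝ)..(2 * Real.pi), sat (k * Real.sin (t + η)) * Real.sin (t + θ) =
      ∫ s in (0 : ℝ)..(2 * Real.pi), sat (k * Real.sin s) * Real.sin (s + (θ - η)) := by
    have e1 := intervalIntegral.integral_comp_add_right (a := 0) (b := 2 * Real.pi)
      (fun s => sat (k * Real.sin s) * Real.sin (s + (θ - η))) η
    have e2 := hper.intervalIntegral_add_eq η 0
    rw [zero_add, add_comm (2 * Real.pi) η, e2, zero_add] at e1
    rw [← e1]
    congr 1
    ext t
    congr 2
    ring
  rw [h3, h2, M, I]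
  ring

theorem period_radialForcing (k η θ : ℝ) :
    PerFun.period (radialForcing (forcingCos k η) (forcingSin k η) θ) =
      M k η (θ + Real.pi / 2) := by
  rw [← period_angularForcing]
  congr 1
  rw [radialForcing, angularForcing, Real.cos_add_pi_div_two, Real.sin_add_pi_div_two, neg_smul]
  abel

/-! ### Rotating, scaled coordinates -/

/-- The curve with rotating coordinates `1 + ε p` (radial) and `ε q` (tangential), in the frame
whose radial direction at time `t` is `xi (t + a)`. -/
noncomputable def orbit (ε : ℝ) (x : PerFun × PerFun × ℝ) (t : ℝ) : ℝ × ℝ :=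
  (Real.sin (t + x.2.2) * (1 + ε * x.1 (t : AddCircle (2 * Real.pi))) +
      Real.cos (t + x.2.2) * (ε * x.2.1 (t : AddCircle (2 * Real.pi))),
    Real.cos (t + x.2.2) * (1 + ε * x.1 (t : AddCircle (2 * Real.pi))) -
      Real.sin (t + x.2.2) * (ε * x.2.1 (t : AddCircle (2 * Real.pi))))

theorem radialRHS_coe (k η ε : ℝ) (x : PerFun × PerFun × ℝ) (t : ℝ) :
    radialRHS (forcingCos k η) (forcingSin k η) (ε, x) (t : AddCircle (2 * Real.pi)) =
      forcing k η t * Real.cos (t + x.2.2) -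
        ε * (x.1 (t : AddCircle (2 * Real.pi)) ^ 2 + x.2.1 (t : AddCircle (2 * Real.pi)) ^ 2 +
          x.1 (t : AddCircle (2 * Real.pi)) * (2 * x.1 (t : AddCircle (2 * Real.pi)) +
            ε * (x.1 (t : AddCircle (2 * Real.pi)) ^ 2 +
              x.2.1 (t : AddCircle (2 * Real.pi)) ^ 2))) := by
  simp only [radialRHS, radialExcess, ContinuousMap.sub_apply, radialForcing_coe,
    ContinuousMap.smul_apply, ContinuousMap.add_apply, ContinuousMap.mul_apply, smul_eq_mul]
  ring

theorem angularRHS_coe (k η ε : ℝ) (x : PerFun × PerFun × ℝ) (t : ℝ) :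
    angularRHS (forcingCos k η) (forcingSin k η) (ε, x) (t : AddCircle (2 * Real.pi)) =
      -(forcing k η t * Real.sin (t + x.2.2)) -
        ε * (x.2.1 (t : AddCircle (2 * Real.pi)) * (2 * x.1 (t : AddCircle (2 * Real.pi)) +
            ε * (x.1 (t : AddCircle (2 * Real.pi)) ^ 2 +
              x.2.1 (t : AddCircle (2 * Real.pi)) ^ 2))) := by
  simp only [angularRHS, radialExcess, ContinuousMap.sub_apply, ContinuousMap.neg_apply,
    angularForcing_coe, ContinuousMap.smul_apply, ContinuousMap.add_apply,
    ContinuousMap.mul_apply, smul_eq_mul]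
  ring

theorem hasDerivAt_sin_add (a t : ℝ) :
    HasDerivAt (fun t => Real.sin (t + a)) (Real.cos (t + a)) t := by
  simpa using ((hasDerivAt_id t).add_const a).sin

theorem hasDerivAt_cos_add (a t : ℝ) :
    HasDerivAt (fun t => Real.cos (t + a)) (-Real.sin (t + a)) t := by
  simpa using ((hasDerivAt_id t).add_const a).cos

theorem isPeriodicSolution_orbit {k η ε : ℝ} {x : PerFun × PerFun × ℝ}
    (h : scaledMap (forcingCos k η) (forcingSin k η) (ε, x) = 0) :
    IsPeriodicSolution k η ε (orbit ε x) := by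
  obtain ⟨hp, hq, -⟩ := (scaledMap_eq_zero_iff _ _).1 h
  refine ⟨fun t => ?_, fun t => ?_⟩
  · have hS := hasDerivAt_sin_add x.2.2 t
    have hC := hasDerivAt_cos_add x.2.2 t
    have hP := ((hp t).const_mul ε).const_add 1
    have hQ := (hq t).const_mul ε
    refine (((hS.mul hP).add (hC.mul hQ)).prodMk ((hC.mul hP).sub (hS.mul hQ))).congr_deriv ?_
    rw [radialRHS_coe, angularRHS_coe]
    have hsc := Real.sin_sq_add_cos_sq (t + x.2.2)
    simp only [field, orbit]
    rw [← forcing]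
    set s := Real.sin (t + x.2.2)
    set c := Real.cos (t + x.2.2)
    set p := x.1 (t : AddCircle (2 * Real.pi))
    set q := x.2.1 (t : AddCircle (2 * Real.pi))
    have hu : (s * (1 + ε * p) + c * (ε * q)) ^ 2 + (c * (1 + ε * p) - s * (ε * q)) ^ 2 =
        (1 + ε * p) ^ 2 + (ε * q) ^ 2 := by
      linear_combination ((1 + ε * p) ^ 2 + (ε * q) ^ 2) * hsc
    rw [hu]
    ext
    · simp only
      ring
    · simp only
      linear_combination (ε * forcing k η t) * hsc
  · have h1 := PerFun.periodic_coe x.1 t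
    have h2 := PerFun.periodic_coe x.2.1 t
    simp only at h1 h2
    rw [orbit, orbit, h1, h2, add_right_comm, Real.sin_add_two_pi, Real.cos_add_two_pi]

theorem continuous_orbit_zero :
    Continuous fun v : ℝ × PerFun × PerFun × ℝ => orbit v.1 v.2 0 := by
  have hev : Continuous fun h : PerFun => h ((0 : ℝ) : AddCircle (2 * Real.pi)) :=
    continuous_eval_const _
  have h1 : Continuous fun v : ℝ × PerFun × PerFun × ℝ =>
      v.2.1 ((0 : ℝ) : AddCircle (2 * Real.pi)) := hev.comp (by fun_prop)
  have h2 : Continuous fun v : ℝ × PerFun × PerFun × ℝ =>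
      v.2.2.1 ((0 : ℝ) : AddCircle (2 * Real.pi)) := hev.comp (by fun_prop)
  unfold orbit
  fun_prop

theorem orbit_zero_zero (x : PerFun × PerFun × ℝ) : orbit 0 x 0 = xi x.2.2 := by
  simp [orbit, xi]

/-! ### A priori bounds for periodic solutions near the unit circle -/

section APriori

variable {k η ε : ℝ} {y : ℝ → ℝ × ℝ}

theorem IsPeriodicSolution.hasDerivAt_fst (hy : IsPeriodicSolution k η ε y) (t : ℝ) :
    HasDerivAt (fun t => (y t).1)
      ((y t).2 - (y t).1 * ((y t).1 ^ 2 + (y t).2 ^ 2 - 1)) t :=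
  (hasFDerivAt_fst (𝕜 := ℝ) (p := y t)).comp_hasDerivAt t (hy.1 t)

theorem IsPeriodicSolution.hasDerivAt_snd (hy : IsPeriodicSolution k η ε y) (t : ℝ) :
    HasDerivAt (fun t => (y t).2)
      (-(y t).1 - (y t).2 * ((y t).1 ^ 2 + (y t).2 ^ 2 - 1) + ε * forcing k η t) t :=
  (hasFDerivAt_snd (𝕜 := ℝ) (p := y t)).comp_hasDerivAt t (hy.1 t)

theorem IsPeriodicSolution.hasDerivAt_normSq (hy : IsPeriodicSolution k η ε y) (t : ℝ) :
    HasDerivAt (fun t => (y t).1 ^ 2 + (y t).2 ^ 2)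
      (2 * ((y t).1 ^ 2 + (y t).2 ^ 2) * (1 - ((y t).1 ^ 2 + (y t).2 ^ 2)) +
        2 * ε * ((y t).2 * forcing k η t)) t := by
  refine (((hy.hasDerivAt_fst t).pow 2).add ((hy.hasDerivAt_snd t).pow 2)).congr_deriv ?_
  push_cast
  ring

theorem IsPeriodicSolution.periodic_normSq (hy : IsPeriodicSolution k η ε y) :
    Function.Periodic (fun t => (y t).1 ^ 2 + (y t).2 ^ 2) (2 * Real.pi) := by
  intro t
  simp only [hy.2 t]

theorem abs_mul_forcing_le (k η t : ℝ) {b c : ℝ} (h : |b| ≤ c) : |b * forcing k η t| ≤ 2 * c := by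
  rw [abs_mul, mul_comm 2 c]
  exact mul_le_mul h (abs_forcing_le k η t) (abs_nonneg _) ((abs_nonneg _).trans h)

/-- The circle of radius `1 / √2` repels outwards, so periodic solutions do not cross it. -/
theorem IsPeriodicSolution.half_le_normSq (hy : IsPeriodicSolution k η ε y) (hε : 0 < ε)
    (hε' : ε ≤ 1 / 100) (h0 : 1 / 2 ≤ (y 0).1 ^ 2 + (y 0).2 ^ 2) (t : ℝ) :
    1 / 2 ≤ (y t).1 ^ 2 + (y t).2 ^ 2 := by
  obtain ⟨s, hs, hst⟩ := hy.periodic_normSq.exists_mem_Ico₀ Real.two_pi_pos t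
  rw [hst]
  have hd (t : ℝ) := (hy.hasDerivAt_normSq t).neg
  have := image_le_of_deriv_right_lt_deriv_boundary (a := 0) (b := 2 * Real.pi)
    (B := fun _ => -(1 / 2 : ℝ)) (B' := fun _ => 0)
    (fun t _ => (hd t).continuousAt.continuousWithinAt)
    (fun t _ => (hd t).hasDerivWithinAt) (by simpa using h0)
    (fun t => hasDerivAt_const t _) (fun t _ ht => ?_) (Ico_subset_Icc_self hs)
  · simpa using this
  · have hu : (y t).1 ^ 2 + (y t).2 ^ 2 = 1 / 2 := neg_injective ht
    have hb : |(y t).2| ≤ 1 := by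
      rw [← sq_le_one_iff_abs_le_one]
      nlinarith [sq_nonneg (y t).1]
    have := (abs_le.1 (abs_mul_forcing_le k η t hb)).1
    rw [hu]
    nlinarith

theorem abs_normSq_sub_one_le_of_critical (hε : 0 < ε) {t : ℝ}
    (hu : 1 / 2 ≤ (y t).1 ^ 2 + (y t).2 ^ 2)
    (hcrit : 2 * ((y t).1 ^ 2 + (y t).2 ^ 2) * (1 - ((y t).1 ^ 2 + (y t).2 ^ 2)) +
        2 * ε * ((y t).2 * forcing k η t) = 0) :
    |(y t).1 ^ 2 + (y t).2 ^ 2 - 1| ≤ 4 * ε := by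
  set u := (y t).1 ^ 2 + (y t).2 ^ 2 with hudef
  have hb : |(y t).2| ≤ 2 * u := by
    apply abs_le_of_sq_le_sq _ (by linarith)
    nlinarith [sq_nonneg (y t).1]
  have h1 := abs_mul_forcing_le k η t hb
  have h2 : u * (u - 1) = ε * ((y t).2 * forcing k η t) := by linarith
  have h3 : u * |u - 1| ≤ ε * (2 * (2 * u)) := by
    calc u * |u - 1| = |u * (u - 1)| := by rw [abs_mul, abs_of_pos (by linarith : 0 < u)]
      _ = ε * |(y t).2 * forcing k η t| := by rw [h2, abs_mul, abs_of_pos hε]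
      _ ≤ _ := mul_le_mul_of_nonneg_left h1 hε.le
  have h4 : u * |u - 1| ≤ u * (4 * ε) := by linarith
  exact le_of_mul_le_mul_left h4 (by linarith)

/-- Both extrema of `|y|²` over a period are critical points, where the equation pins `|y|²`
to within `O(ε)` of `1`. -/
theorem IsPeriodicSolution.abs_normSq_sub_one_le (hy : IsPeriodicSolution k η ε y) (hε : 0 < ε)
    (hε' : ε ≤ 1 / 100) (h0 : 1 / 2 ≤ (y 0).1 ^ 2 + (y 0).2 ^ 2) (t : ℝ) :
    |(y t).1 ^ 2 + (y t).2 ^ 2 - 1| ≤ 4 * ε := by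
  set u : ℝ → ℝ := fun t => (y t).1 ^ 2 + (y t).2 ^ 2 with hu
  have hcont : Continuous u :=
    continuous_iff_continuousAt.2 fun t => (hy.hasDerivAt_normSq t).continuousAt
  have hred (t : ℝ) : ∃ s ∈ Icc 0 (2 * Real.pi), u t = u s := by
    obtain ⟨s, hs, hst⟩ := hy.periodic_normSq.exists_mem_Ico₀ Real.two_pi_pos t
    exact ⟨s, Ico_subset_Icc_self hs, hst⟩
  have hne : (Icc 0 (2 * Real.pi)).Nonempty := nonempty_Icc.2 Real.two_pi_pos.le
  obtain ⟨a, -, ha⟩ := isCompact_Icc.exists_isMinOn hne hcont.continuousOn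
  obtain ⟨b, -, hb⟩ := isCompact_Icc.exists_isMaxOn hne hcont.continuousOn
  have hmin (t : ℝ) : u a ≤ u t := by
    obtain ⟨s, hs, hst⟩ := hred t
    rw [hst]
    exact ha hs
  have hmax (t : ℝ) : u t ≤ u b := by
    obtain ⟨s, hs, hst⟩ := hred t
    rw [hst]
    exact hb hs
  have hhalf := hy.half_le_normSq hε hε' h0
  have h1 := abs_normSq_sub_one_le_of_critical hε (hhalf a)
    (IsLocalMin.hasDerivAt_eq_zero (Eventually.of_forall hmin) (hy.hasDerivAt_normSq a))
  have h2 := abs_normSq_sub_one_le_of_critical hε (hhalf b)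
    (IsLocalMax.hasDerivAt_eq_zero (Eventually.of_forall hmax) (hy.hasDerivAt_normSq b))
  have h3 := hmin t
  have h4 := hmax t
  simp only [hu] at h3 h4
  rw [abs_le] at *
  constructor <;> linarith [h1.1, h1.2, h2.1, h2.2]

theorem abs_le_of_abs_deriv_le {g g' : ℝ → ℝ} {A B C : ℝ} (hg : ∀ t, HasDerivAt g (g' t) t)
    (hB : ∀ t, |g' t| ≤ B) (hA : |g 0| ≤ A) (hC : A + B * (2 * Real.pi) ≤ C) {t : ℝ}
    (ht : t ∈ Icc 0 (2 * Real.pi)) : |g t| ≤ C := by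
  have h1 := Convex.norm_image_sub_le_of_norm_hasDerivWithin_le
    (fun t _ => (hg t).hasDerivWithinAt) (fun t _ => hB t) convex_univ
    (mem_univ (0 : ℝ)) (mem_univ t)
  rw [sub_zero, Real.norm_eq_abs, Real.norm_eq_abs, abs_of_nonneg ht.1] at h1
  have h2 : B * t ≤ B * (2 * Real.pi) :=
    mul_le_mul_of_nonneg_left ht.2 ((abs_nonneg _).trans (hB 0))
  have h3 := abs_sub_abs_le_abs_sub (g t) (g 0)
  linarith

/-- In rotating coordinates adapted to the phase of its initial condition, a periodic solution
near the unit circle solves the scaled problem, with bounds uniform in `ε`. -/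
theorem IsPeriodicSolution.exists_scaled (hy : IsPeriodicSolution k η ε y) (hε : 0 < ε)
    (hε' : ε ≤ 1 / 100) (h0 : 1 / 2 ≤ (y 0).1 ^ 2 + (y 0).2 ^ 2) {r a : ℝ} (hr : 0 ≤ r)
    (ha : y 0 = (r * Real.sin a, r * Real.cos a)) :
    ∃ p q : PerFun, y = orbit ε (p, q, a) ∧
      scaledMap (forcingCos k η) (forcingSin k η) (ε, p, q, a) = 0 ∧ ‖p‖ ≤ 80 ∧ ‖q‖ ≤ 80 := by
  set u : ℝ → ℝ := fun t => (y t).1 ^ 2 + (y t).2 ^ 2 with hu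
  have hub := hy.abs_normSq_sub_one_le hε hε' h0
  set P : ℝ → ℝ := fun t => Real.sin (t + a) * (y t).1 + Real.cos (t + a) * (y t).2 with hP
  set Q : ℝ → ℝ := fun t => Real.cos (t + a) * (y t).1 - Real.sin (t + a) * (y t).2 with hQ
  have hPQ (t : ℝ) : P t ^ 2 + Q t ^ 2 = u t := by
    simp only [hP, hQ, hu]
    linear_combination ((y t).1 ^ 2 + (y t).2 ^ 2) * Real.sin_sq_add_cos_sq (t + a)
  have hPd (t : ℝ) : HasDerivAt P
      (-(P t * (u t - 1)) + ε * (Real.cos (t + a) * forcing k η t)) t := by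
    refine (((hasDerivAt_sin_add a t).mul (hy.hasDerivAt_fst t)).add
      ((hasDerivAt_cos_add a t).mul (hy.hasDerivAt_snd t))).congr_deriv ?_
    simp only [hP, hu]
    ring
  have hQd (t : ℝ) : HasDerivAt Q
      (-(Q t * (u t - 1)) - ε * (Real.sin (t + a) * forcing k η t)) t := by
    refine (((hasDerivAt_cos_add a t).mul (hy.hasDerivAt_fst t)).sub
      ((hasDerivAt_sin_add a t).mul (hy.hasDerivAt_snd t))).congr_deriv ?_
    simp only [hQ, hu]
    ring
  have hu2 (t : ℝ) : u t ≤ 2 ^ 2 := by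
    have := (abs_le.1 (hub t)).2
    simp only [hu]
    linarith
  have hP2 (t : ℝ) : |P t| ≤ 2 :=
    abs_le_of_sq_le_sq (by nlinarith [hPQ t, hu2 t, sq_nonneg (Q t)]) (by norm_num)
  have hQ2 (t : ℝ) : |Q t| ≤ 2 :=
    abs_le_of_sq_le_sq (by nlinarith [hPQ t, hu2 t, sq_nonneg (P t)]) (by norm_num)
  have hdrift {b : ℝ} (hb : |b| ≤ 2) (t : ℝ) : |b * (u t - 1)| ≤ 8 * ε := by
    rw [abs_mul]
    calc |b| * |u t - 1| ≤ 2 * (4 * ε) := mul_le_mul hb (hub t) (abs_nonneg _) (by norm_num)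
      _ = 8 * ε := by ring
  have hforce {b : ℝ} (hb : |b| ≤ 1) (t : ℝ) : |ε * (b * forcing k η t)| ≤ 2 * ε := by
    rw [abs_mul, abs_of_pos hε]
    have := abs_mul_forcing_le k η t hb
    nlinarith
  have hP0 : P 0 = r := by
    simp only [hP, zero_add, ha]
    linear_combination r * Real.sin_sq_add_cos_sq a
  have hQ0 : Q 0 = 0 := by
    simp only [hQ, zero_add, ha]
    ring
  have hpi := Real.pi_lt_d2
  -- the deviations start at most `4 ε` and grow at rate at most `10 ε`; `4 + 20 π < 80`
  have hPb {t : ℝ} (ht : t ∈ Icc 0 (2 * Real.pi)) : |P t - 1| ≤ 80 * ε := by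
    refine abs_le_of_abs_deriv_le (A := 4 * ε) (B := 10 * ε)
      (fun t => (hPd t).sub_const 1) (fun t => ?_) ?_ (by nlinarith) ht
    · refine (abs_add_le _ _).trans ?_
      rw [abs_neg]
      linarith [hdrift (hP2 t) t, hforce (Real.abs_cos_le_one (t + a)) t]
    · have h1 : r ^ 2 = u 0 := by
        rw [← hPQ 0, hP0, hQ0]
        ring
      have h2 : |u 0 - 1| ≤ 4 * ε := hub 0
      rw [← h1, show r ^ 2 - 1 = (r - 1) * (r + 1) by ring, abs_mul,
        abs_of_pos (by linarith : 0 < r + 1)] at h2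
      rw [hP0]
      nlinarith [abs_nonneg (r - 1)]
  have hQb {t : ℝ} (ht : t ∈ Icc 0 (2 * Real.pi)) : |Q t| ≤ 80 * ε := by
    refine abs_le_of_abs_deriv_le (A := 0) (B := 10 * ε) hQd (fun t => ?_) (by simp [hQ0])
      (by nlinarith) ht
    refine (abs_sub _ _).trans ?_
    rw [abs_neg]
    linarith [hdrift (hQ2 t) t, hforce (Real.abs_sin_le_one (t + a)) t]
  have hPper : Function.Periodic P (2 * Real.pi) := by
    intro t
    simp only [hP]
    rw [hy.2 t, add_right_comm, Real.sin_add_two_pi, Real.cos_add_two_pi]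
  have hQper : Function.Periodic Q (2 * Real.pi) := by
    intro t
    simp only [hQ]
    rw [hy.2 t, add_right_comm, Real.sin_add_two_pi, Real.cos_add_two_pi]
  have hPc : Continuous P := continuous_iff_continuousAt.2 fun t => (hPd t).continuousAt
  have hQc : Continuous Q := continuous_iff_continuousAt.2 fun t => (hQd t).continuousAt
  set p : PerFun := PerFun.ofPeriodic (fun t => (P t - 1) / ε) (by fun_prop)
    (fun t => by simp only [hPper t]) with hp
  set q : PerFun := PerFun.ofPeriodic (fun t => Q t / ε) (by fun_prop)
    (fun t => by simp only [hQper t]) with hq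
  have hpc (t : ℝ) : p (t : AddCircle (2 * Real.pi)) = (P t - 1) / ε := rfl
  have hqc (t : ℝ) : q (t : AddCircle (2 * Real.pi)) = Q t / ε := rfl
  -- the scaled form of `P² + Q² = |y|²`
  have hex (t : ℝ) : u t - 1 = ε * (2 * ((P t - 1) / ε) +
      ε * (((P t - 1) / ε) ^ 2 + (Q t / ε) ^ 2)) := by
    rw [← hPQ t]
    field_simp
    ring
  refine ⟨p, q, ?_, ?_, ?_, ?_⟩
  · ext t
    · simp only [orbit, hpc, hqc, mul_div_cancel₀ _ hε.ne', hP, hQ]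
      linear_combination -(y t).1 * Real.sin_sq_add_cos_sq (t + a)
    · simp only [orbit, hpc, hqc, mul_div_cancel₀ _ hε.ne', hP, hQ]
      linear_combination -(y t).2 * Real.sin_sq_add_cos_sq (t + a)
  · refine (scaledMap_eq_zero_iff _ _).2 ⟨fun t => ?_, fun t => ?_, ?_⟩
    · refine (((hPd t).sub_const 1).div_const ε).congr_deriv ?_
      rw [radialRHS_coe]
      simp only [hpc, hqc]
      rw [hex]
      field_simp
      ring
    · refine ((hQd t).div_const ε).congr_deriv ?_
      rw [angularRHS_coe]
      simp only [hpc, hqc]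
      rw [hex]
      field_simp
      ring
    · simp only [hqc, hQ0, zero_div]
  · refine PerFun.norm_le_of_forall_Icc (by norm_num) fun t ht => ?_
    rw [hpc, abs_div, abs_of_pos hε, div_le_iff₀ hε]
    exact hPb ht
  · refine PerFun.norm_le_of_forall_Icc (by norm_num) fun t ht => ?_
    rw [hqc, abs_div, abs_of_pos hε, div_le_iff₀ hε]
    exact hQb ht

end APriori

/-! ### Periodic solutions near the circle lie on the bifurcating branches -/

/-- A bounded solution of the scaled problem is `O(ε)`-close to the base point of its phase, and
its phase is an approximate zero of `M`. -/
theorem exists_scaled_estimate (k η : ℝ) : ∃ K > 0, ∀ ε p q a, 0 < ε → ε ≤ 1 / 100 →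
    ‖p‖ ≤ 80 → ‖q‖ ≤ 80 →
    scaledMap (forcingCos k η) (forcingSin k η) (ε, p, q, a) = 0 →
    dist (p, q, a) (basePoint (forcingCos k η) (forcingSin k η) a) ≤ K * ε ∧
      |M k η a| ≤ K * ε := by
  set K : ℝ := 40000 * (‖PerFun.relax‖ + ‖PerFun.primitive‖ + ‖PerFun.period‖) + 1 with hK
  have hL := norm_nonneg PerFun.relax
  have hJ := norm_nonneg PerFun.primitive
  have hm := norm_nonneg PerFun.period
  refine ⟨K, by positivity, fun ε p q a hε hε' hp hq h => ?_⟩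
  have hpp : ‖p * p + q * q‖ ≤ 12800 := by
    calc ‖p * p + q * q‖ ≤ ‖p‖ * ‖p‖ + ‖q‖ * ‖q‖ :=
          (norm_add_le _ _).trans (add_le_add (norm_mul_le _ _) (norm_mul_le _ _))
      _ ≤ 80 * 80 + 80 * 80 := by gcongr
      _ = 12800 := by norm_num
  have hN : ‖radialExcess ε p q‖ ≤ 300 := by
    calc ‖radialExcess ε p q‖ ≤ 2 * ‖p‖ + ε * ‖p * p + q * q‖ := by
          refine (norm_add_le _ _).trans ?_
          rw [norm_smul, norm_smul, Real.norm_of_nonneg hε.le, Real.norm_ofNat]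
      _ ≤ 2 * 80 + 1 / 100 * 12800 := by gcongr
      _ ≤ 300 := by norm_num
  have hR : ‖p * p + q * q + p * radialExcess ε p q‖ ≤ 40000 := by
    calc _ ≤ ‖p * p + q * q‖ + ‖p‖ * ‖radialExcess ε p q‖ :=
          (norm_add_le _ _).trans (add_le_add le_rfl (norm_mul_le _ _))
      _ ≤ 12800 + 80 * 300 := by gcongr
      _ ≤ 40000 := by norm_num
  have hA : ‖q * radialExcess ε p q‖ ≤ 40000 := by
    calc _ ≤ ‖q‖ * ‖radialExcess ε p q‖ := norm_mul_le _ _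
      _ ≤ 80 * 300 := by gcongr
      _ ≤ 40000 := by norm_num
  simp only [scaledMap, Prod.mk_eq_zero, radialRHS, angularRHS, map_sub, map_neg, map_smul] at h
  obtain ⟨h1, h2, h3⟩ := h
  rw [period_angularForcing] at h3
  have bound {F : Type} [NormedAddCommGroup F] [NormedSpace ℝ F] (T : PerFun →L[ℝ] F)
      (hT : 40000 * ‖T‖ ≤ K) {w : PerFun} (hw : ‖w‖ ≤ 40000) : ‖ε • T w‖ ≤ K * ε := by
    rw [norm_smul, Real.norm_of_nonneg hε.le, mul_comm]
    have : ‖T w‖ ≤ ‖T‖ * 40000 := (T.le_opNorm w).trans (by gcongr)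
    exact mul_le_mul_of_nonneg_right (by linarith) hε.le
  refine ⟨?_, ?_⟩
  · simp only [basePoint, Prod.dist_eq, dist_self]
    refine max_le ?_ (max_le ?_ (by positivity))
    · have e : p - PerFun.relax (radialForcing (forcingCos k η) (forcingSin k η) a) =
          -(ε • PerFun.relax (p * p + q * q + p * radialExcess ε p q)) := by
        rw [eq_neg_iff_add_eq_zero, ← h1]
        abel
      rw [dist_eq_norm, e, norm_neg]
      exact bound _ (by linarith) hR
    · have e : q - -PerFun.primitive (angularForcing (forcingCos k η) (forcingSin k η) a) =
          -(ε • PerFun.primitive (q * radialExcess ε p q)) := by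
        rw [eq_neg_iff_add_eq_zero, ← h2]
        abel
      rw [dist_eq_norm, e, norm_neg]
      exact bound _ (by linarith) hA
  · have e : M k η a = -(ε • PerFun.period (q * radialExcess ε p q)) := by
      linarith
    rw [e, abs_neg]
    exact bound _ (by linarith) hA

theorem exists_polar (z : ℝ × ℝ) :
    ∃ r a : ℝ, 0 ≤ r ∧ z = (r * Real.sin a, r * Real.cos a) := by
  refine ⟨‖(⟨z.2, z.1⟩ : ℂ)‖, Complex.arg ⟨z.2, z.1⟩, norm_nonneg _, ?_⟩
  rw [Complex.norm_mul_sin_arg, Complex.norm_mul_cos_arg]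

theorem half_le_normSq_of_dist_xi_lt {z : ℝ × ℝ} {θ : ℝ} (h : dist z (xi θ) < 1 / 10) :
    1 / 2 ≤ z.1 ^ 2 + z.2 ^ 2 := by
  rw [Prod.dist_eq, max_lt_iff, Real.dist_eq, Real.dist_eq, xi, abs_lt, abs_lt] at h
  obtain ⟨⟨h1, h2⟩, h3, h4⟩ := h
  simp only at h1 h2 h3 h4
  have hs := Real.sin_sq_add_cos_sq θ
  have b1 : (1 / 10 - (z.1 - Real.sin θ)) * (1 / 10 + (z.1 - Real.sin θ)) ≥ 0 :=
    mul_nonneg (by linarith) (by linarith)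
  have b2 : (1 / 10 - (z.2 - Real.cos θ)) * (1 / 10 + (z.2 - Real.cos θ)) ≥ 0 :=
    mul_nonneg (by linarith) (by linarith)
  -- `1 = |xi θ|² ≤ (3/2) |z|² + 3 |z - xi θ|²`
  nlinarith [sq_nonneg (z.1 - 2 * (Real.sin θ - z.1)), sq_nonneg (z.2 - 2 * (Real.cos θ - z.2))]

theorem exists_forall_mem_of_near_basePoint (fc fs : PerFun) {θ K : ℝ} (hK : 0 < K)
    {W : Set (ℝ × PerFun × PerFun × ℝ)} (hW : W ∈ 𝓝 ((0 : ℝ), basePoint fc fs θ)) :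
    ∃ r > 0, ∀ ε x, 0 < ε → ε < r → |x.2.2 - θ| < r →
      dist x (basePoint fc fs x.2.2) ≤ K * ε → (ε, x) ∈ W := by
  obtain ⟨ρ, hρ, hball⟩ := Metric.mem_nhds_iff.1 hW
  obtain ⟨r, hr, hb⟩ := Metric.continuousAt_iff.1 ((continuous_basePoint fc fs).continuousAt
    (x := θ)) (ρ / 2) (by positivity)
  refine ⟨min r (min ρ (ρ / (2 * K))), by positivity, fun ε x hε hlt hx hd => hball ?_⟩
  simp only [lt_min_iff] at hlt hx
  have h1 := hb (x := x.2.2) (by rw [Real.dist_eq]; exact hx.1)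
  have h2 : K * ε < ρ / 2 := by
    have := (lt_div_iff₀ (by positivity)).1 hlt.2.2
    linarith
  rw [Metric.mem_ball, Prod.dist_eq, max_lt_iff]
  refine ⟨by rw [Real.dist_eq, sub_zero, abs_of_pos hε]; exact hlt.2.1, ?_⟩
  linarith [dist_triangle x (basePoint fc fs x.2.2) (basePoint fc fs θ)]

/-- Every periodic solution starting near the unit circle comes, for small `ε`, from a solution
of the scaled problem in prescribed neighbourhoods of the two base points. -/
theorem exists_forall_exists_scaled_mem {k η c θ₁ : ℝ} (hc : c ≠ 0)
    (hM : ∀ θ, M k η θ = c * Real.sin (θ - θ₁)) {W₁ W₂ : Set (ℝ × PerFun × PerFun × ℝ)}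
    (hW₁ : W₁ ∈ 𝓝 ((0 : ℝ), basePoint (forcingCos k η) (forcingSin k η) θ₁))
    (hW₂ : W₂ ∈ 𝓝 ((0 : ℝ), basePoint (forcingCos k η) (forcingSin k η) (θ₁ + Real.pi))) :
    ∃ ε₀ > 0, ∀ ε y, 0 < ε → ε < ε₀ → IsPeriodicSolution k η ε y →
      (∃ θ, dist (y 0) (xi θ) < 1 / 10) →
      ∃ x, y = orbit ε x ∧ scaledMap (forcingCos k η) (forcingSin k η) (ε, x) = 0 ∧
        ((ε, x) ∈ W₁ ∨ (ε, x) ∈ W₂) := by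
  obtain ⟨K, hK, hest⟩ := exists_scaled_estimate k η
  obtain ⟨r₁, hr₁, hmem₁⟩ := exists_forall_mem_of_near_basePoint _ _ hK hW₁
  obtain ⟨r₂, hr₂, hmem₂⟩ := exists_forall_mem_of_near_basePoint _ _ hK hW₂
  obtain ⟨κ, hκ, hnear⟩ := exists_near_zero_of_abs_mul_sin_lt (θ₁ := θ₁) hc (lt_min hr₁ hr₂)
  refine ⟨min (1 / 100) (min (κ / K) (min r₁ r₂)), by positivity,
    fun ε y hε hlt hy ⟨θ, hθ⟩ => ?_⟩
  simp only [lt_min_iff] at hlt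
  obtain ⟨hlt0, hltκ, hlt1, hlt2⟩ := hlt
  have h0 := half_le_normSq_of_dist_xi_lt hθ
  obtain ⟨r, a, hr, ha⟩ := exists_polar (y 0)
  obtain ⟨p, q, -, hF, hp, hq⟩ := hy.exists_scaled hε hlt0.le h0 hr ha
  have hMa := (hest ε p q a hε hlt0.le hp hq hF).2
  rw [hM] at hMa
  obtain ⟨m, hm⟩ := hnear a (hMa.trans_lt (by rw [mul_comm]; exact (lt_div_iff₀ hK).1 hltκ))
  -- the phase is only determined modulo `2π`; choose the representative near a zero of `M`
  have ha' : y 0 = (r * Real.sin (a + m * (2 * Real.pi)), r * Real.cos (a + m * (2 * Real.pi))) := by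
    rw [Real.sin_add_int_mul_two_pi, Real.cos_add_int_mul_two_pi, ha]
  obtain ⟨p, q, hyo, hF, hp, hq⟩ := hy.exists_scaled hε hlt0.le h0 hr ha'
  have hd := (hest ε p q _ hε hlt0.le hp hq hF).1
  refine ⟨(p, q, a + m * (2 * Real.pi)), hyo, hF, hm.imp (fun h => ?_) fun h => ?_⟩
  · exact hmem₁ ε _ hε hlt1 (h.trans_le (min_le_left _ _)) hd
  · exact hmem₂ ε _ hε hlt2 (h.trans_le (min_le_right _ _)) hd

theorem exists_orbit_branch {k η θ : ℝ} (h0 : M k η θ = 0) (h1 : M k η (θ + Real.pi / 2) ≠ 0) :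
    ∃ ψ : ℝ → PerFun × PerFun × ℝ,
      (∀ᶠ ε in 𝓝[>] 0, IsPeriodicSolution k η ε (orbit ε (ψ ε))) ∧
      Tendsto (fun ε => orbit ε (ψ ε) 0) (𝓝[>] 0) (𝓝 (xi θ)) ∧
      ∀ᶠ v in 𝓝 ((0 : ℝ), basePoint (forcingCos k η) (forcingSin k η) θ),
        scaledMap (forcingCos k η) (forcingSin k η) v = 0 → ψ v.1 = v.2 := by
  obtain ⟨ψ, hψ, hsol, huniq⟩ := exists_branch (forcingCos k η) (forcingSin k η) (θ := θ)
    (by rw [period_angularForcing, h0]) (by rwa [period_radialForcing])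
  refine ⟨ψ, ?_, ?_, huniq⟩
  · exact (hsol.filter_mono nhdsWithin_le_nhds).mono fun ε h => isPeriodicSolution_orbit h
  · have h2 : Tendsto (fun ε => (ε, ψ ε)) (𝓝 0)
        (𝓝 ((0 : ℝ), basePoint (forcingCos k η) (forcingSin k η) θ)) :=
      tendsto_id.prodMk_nhds hψ
    have h3 := (continuous_orbit_zero.tendsto _).comp h2
    rw [orbit_zero_zero] at h3
    exact h3.mono_left nhdsWithin_le_nhds

theorem xi_ne_xi_add_pi (θ : ℝ) : xi θ ≠ xi (θ + Real.pi) := by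
  intro h
  simp only [xi, Real.sin_add_pi, Real.cos_add_pi, Prod.mk.injEq] at h
  have := Real.sin_sq_add_cos_sq θ
  have h1 : Real.sin θ = 0 := by linarith [h.1]
  have h2 : Real.cos θ = 0 := by linarith [h.2]
  simp [h1, h2] at this

/-- If there are only two periodic solutions near the circle and their initial conditions differ,
then each of them is isolated. -/
theorem isIsolatedPeriodicSolution_of_pair {k η ε δ θ : ℝ} {x₁ x₂ : ℝ → ℝ × ℝ}
    (h : {y : ℝ → ℝ × ℝ | IsPeriodicSolution k η ε y ∧ ∃ θ : ℝ, dist (y 0) (xi θ) < δ} = {x₁, x₂})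
    (hne : x₁ 0 ≠ x₂ 0) (hθ : dist (x₁ 0) (xi θ) < δ) :
    IsIsolatedPeriodicSolution k η ε x₁ := by
  have hx₁ : x₁ ∈ {y : ℝ → ℝ × ℝ | IsPeriodicSolution k η ε y ∧
      ∃ θ : ℝ, dist (y 0) (xi θ) < δ} := by simp [h]
  refine ⟨hx₁.1, min (dist (x₂ 0) (x₁ 0)) (δ - dist (x₁ 0) (xi θ)),
    lt_min (dist_pos.2 hne.symm) (sub_pos.2 hθ), fun y hy hd => ?_⟩
  rw [lt_min_iff] at hd
  have hy' : y ∈ {y : ℝ → ℝ × ℝ | IsPeriodicSolution k η ε y ∧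
      ∃ θ : ℝ, dist (y 0) (xi θ) < δ} :=
    ⟨hy, θ, by linarith [dist_triangle (y 0) (x₁ 0) (xi θ)]⟩
  rw [h] at hy'
  rcases hy' with rfl | rfl
  · rfl
  · exact absurd hd.1 (lt_irrefl _)

end ForcedPlanar

theorem proposition2 (k η : ℝ)
    (h₁ : ¬ (k = 1 ∧ ∃ n : ℤ, η = Real.pi + 2 * Real.pi * n))
    (h₂ : ¬ (k = -1 ∧ ∃ n : ℤ, η = 2 * Real.pi * n)) :
    ∃ θ₁ θ₂ : ℝ, θ₁ ≠ θ₂ ∧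
      {θ : ℝ | θ ∈ Ico 0 (2 * Real.pi) ∧ ForcedPlanar.M k η θ = 0} = {θ₁, θ₂} ∧
      ∃ ε₁ > 0, ∃ δ > 0, ∃ x₁ x₂ : ℝ → ℝ → ℝ × ℝ,
        (∀ ε ∈ Ioc 0 ε₁,
          x₁ ε ≠ x₂ ε ∧
          ForcedPlanar.IsIsolatedPeriodicSolution k η ε (x₁ ε) ∧
          ForcedPlanar.IsIsolatedPeriodicSolution k η ε (x₂ ε) ∧
          {y : ℝ → ℝ × ℝ | ForcedPlanar.IsPeriodicSolution k η ε y ∧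
              ∃ θ : ℝ, dist (y 0) (ForcedPlanar.xi θ) < δ} = {x₁ ε, x₂ ε}) ∧
        Tendsto (fun ε => x₁ ε 0) (𝓝[>] 0) (𝓝 (ForcedPlanar.xi θ₁)) ∧
        Tendsto (fun ε => x₂ ε 0) (𝓝[>] 0) (𝓝 (ForcedPlanar.xi θ₂)) := by
  obtain ⟨c, θ₁, hc, hθ₁, hcs⟩ :=
    ForcedPlanar.exists_amplitude_phase (ForcedPlanar.M_coefficients_ne_zero h₁ h₂)
  have hM (θ : ℝ) : ForcedPlanar.M k η θ = c * Real.sin (θ - θ₁) := by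
    rw [ForcedPlanar.M_eq, hcs]
  have hz₁ : ForcedPlanar.M k η θ₁ = 0 := by simp [hM]
  have hz₂ : ForcedPlanar.M k η (θ₁ + Real.pi) = 0 := by simp [hM]
  have hd₁ : ForcedPlanar.M k η (θ₁ + Real.pi / 2) ≠ 0 := by simpa [hM] using hc
  have hd₂ : ForcedPlanar.M k η (θ₁ + Real.pi + Real.pi / 2) ≠ 0 := by
    rw [hM, show θ₁ + Real.pi + Real.pi / 2 - θ₁ = Real.pi / 2 + Real.pi by ring, Real.sin_add_pi]
    simpa using hc
  refine ⟨θ₁, θ₁ + Real.pi, by linarith [Real.pi_pos], ?_, ?_⟩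
  · simp only [hM]
    exact ForcedPlanar.setOf_mul_sin_sub_eq_zero hc hθ₁
  obtain ⟨ψ₁, hsol₁, hlim₁, huniq₁⟩ := ForcedPlanar.exists_orbit_branch hz₁ hd₁
  obtain ⟨ψ₂, hsol₂, hlim₂, huniq₂⟩ := ForcedPlanar.exists_orbit_branch hz₂ hd₂
  obtain ⟨ε₀, hε₀, hall⟩ :=
    ForcedPlanar.exists_forall_exists_scaled_mem hc hM huniq₁ huniq₂
  have hball (θ : ℝ) : ∀ᶠ z in 𝓝 (ForcedPlanar.xi θ), dist z (ForcedPlanar.xi θ) < 1 / 10 :=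
    Metric.ball_mem_nhds _ (by norm_num)
  have hne : ∀ᶠ ε in 𝓝[>] (0 : ℝ),
      ForcedPlanar.orbit ε (ψ₁ ε) 0 ≠ ForcedPlanar.orbit ε (ψ₂ ε) 0 :=
    (hlim₁.prodMk_nhds hlim₂).eventually
      (isClosed_diagonal.isOpen_compl.mem_nhds (ForcedPlanar.xi_ne_xi_add_pi θ₁))
  obtain ⟨ε₁, hε₁, hgood⟩ := (mem_nhdsGT_iff_exists_Ioc_subset).1
    (hsol₁.and (hsol₂.and ((hlim₁.eventually (hball _)).and
      ((hlim₂.eventually (hball _)).and (hne.and (Ioo_mem_nhdsGT hε₀))))))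
  refine ⟨ε₁, hε₁, 1 / 10, by norm_num, fun ε => ForcedPlanar.orbit ε (ψ₁ ε),
    fun ε => ForcedPlanar.orbit ε (ψ₂ ε), fun ε hε => ?_, hlim₁, hlim₂⟩
  obtain ⟨hs₁, hs₂, hb₁, hb₂, hne, -, hlt⟩ := hgood hε
  have hset : {y : ℝ → ℝ × ℝ | ForcedPlanar.IsPeriodicSolution k η ε y ∧
      ∃ θ : ℝ, dist (y 0) (ForcedPlanar.xi θ) < 1 / 10} =
      {ForcedPlanar.orbit ε (ψ₁ ε), ForcedPlanar.orbit ε (ψ₂ ε)} := by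
    ext y
    constructor
    · rintro ⟨hy, hyθ⟩
      obtain ⟨x, rfl, hF, hW⟩ := hall ε y hε.1 hlt hy hyθ
      refine hW.imp (fun h => ?_) fun h => ?_
      · rw [show ψ₁ ε = x from h hF]
      · rw [mem_singleton_iff, show ψ₂ ε = x from h hF]
    · rintro (rfl | rfl)
      · exact ⟨hs₁, _, hb₁⟩
      · exact ⟨hs₂, _, hb₂⟩
  refine ⟨fun h => hne (congrFun h 0),
    ForcedPlanar.isIsolatedPeriodicSolution_of_pair hset hne hb₁, ?_, hset⟩
  rw [pair_comm] at hset
  exact ForcedPlanar.isIsolatedPeriodicSolution_of_pair hset hne.symm hb₂
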